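/- For a matrix $W\in\mathbb{R}^{m\times n}$ let $\operatorname{ReLU}(Wx)\in\mathbb{R}^m$ be obtained by applying $t\mapsto\max(t,0)$ to each coordinate of $Wx$, and let $\operatorname{erfc}(z)=1-\frac{2}{\sqrt{\pi}}\int_0^z e^{-t^2}\,dt$. The equation $$\tfrac12\operatorname{erfc}\!\Big(\frac{1}{\sqrt{2c}}\Big)=\frac1c$$ has a unique positive real solution $c=c^*$, and $c^*\approx 3.4$ (precisely, $|c^*-3.4|<0.05$). Let $c<c^*$, and let $n\to\infty$ and $m=m(n)$ be such that $m/n\to c$. If $W\in\mathbb{R}^{m\times n}$ has independent standard normal entries, then the probability that the layer $\mathbb{R}^n\ni x\mapsto \operatorname{ReLU}(Wx)\in\mathbb{R}^m$ is not injective tends to $1$. -/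

import Mathlib

open Filter Topology MeasureTheory ProbabilityTheory

/-- The complementary error function `erfc z = 1 - (2 / √π) ∫₀ᶻ exp (-t²) dt`.
(For `z < 0` the interval integral is minus the integral over `[z, 0]`.) -/
noncomputable def erfc (z : ℝ) : ℝ :=
  1 - 2 / √Real.pi * ∫ t in (0 : ℝ)..z, Real.exp (-t ^ 2)

/-- The ReLU layer `x ↦ ReLU (W x)`, where `ReLU y = max y 0` acts coordinatewise. -/
noncomputable def reluLayer {m n : ℕ} (W : Matrix (Fin m) (Fin n) ℝ) (x : Fin n → ℝ) :
    Fin m → ℝ :=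
  fun i => max (W.mulVec x i) 0

/-- `W` is an `m × n` random matrix on `(Ω, P)` whose entries are independent standard
normal random variables. -/
structure IsStdGaussianMatrix {Ω : Type*} [MeasurableSpace Ω] (P : Measure Ω) {m n : ℕ}
    (W : Ω → Matrix (Fin m) (Fin n) ℝ) : Prop where
  hasLaw_entry : ∀ i j, HasLaw (fun ω => W ω i j) (gaussianReal 0 1) P
  iIndepFun_entry : iIndepFun (fun (p : Fin m × Fin n) ω => W ω p.1 p.2) P

/-- `c` is a positive real solution of `(1 / 2) erfc (1 / √(2 c)) = 1 / c`. -/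
def IsCriticalExpansivity (c : ℝ) : Prop :=
  0 < c ∧ 1 / 2 * erfc (1 / √(2 * c)) = 1 / c

/-! Test injectivity at minus the sum of the rows. If fewer than n rows have nonpositive product
with the row sum, some nonzero v is orthogonal to all of them, and moving slightly along v changes
no output (`not_injective_reluLayer`).

To count these rows, split a Gaussian matrix into its centred part and its column means, which are
independent: the means may be replaced by s / √m with a fresh Gaussian s
(`measurePreserving_recenter`). The row sum is then √m s, and the i-th product is a positive
multiple of g_i - mean(g) + |s| / √m, where the g_i are iid standard normal (`sum_recenter_mul_sum`,
`measurePreserving_directionImage`). By the law of large numbers mean(g) ≈ 0 and |s| / √m ≈ √(n/m) ≈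
1/√c, so the fraction of bad rows is about P(g ≤ -1/√c) = erfc(1/√(2c))/2. Below the critical value
this is less than 1/c ≈ n/m. -/

/-- If fewer than `n` rows of `W` have nonnegative inner product with `x`, then the layer
`x ↦ ReLU (W x)` is constant along a segment through `x`. -/
theorem not_injective_reluLayer {m n : ℕ} (W : Matrix (Fin m) (Fin n) ℝ) (x : Fin n → ℝ)
    (h : (Finset.univ.filter fun i => 0 ≤ W.mulVec x i).card < n) :
    ¬ Function.Injective (reluLayer W) := by
  intro hinj
  let F : (Fin n → ℝ) →ₗ[ℝ] ({i // 0 ≤ W.mulVec x i} → ℝ) :=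
    (LinearMap.funLeft ℝ ℝ Subtype.val).comp W.mulVecLin
  have hF : LinearMap.ker F ≠ ⊥ := F.ker_ne_bot_of_finrank_lt <| by
    rw [Module.finrank_fintype_fun_eq_card, Module.finrank_fintype_fun_eq_card, Fintype.card_fin,
      Fintype.card_subtype]
    exact h
  obtain ⟨v, hv, hv0⟩ := (Submodule.ne_bot_iff _).1 hF
  have hvI : ∀ i, 0 ≤ W.mulVec x i → W.mulVec v i = 0 := fun i hi =>
    congrFun (LinearMap.mem_ker.1 hv) ⟨i, hi⟩
  -- Finitely many strict inequalities survive a small step; the punctured neighbourhood makes the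
  -- step nonzero.
  have hev : ∀ᶠ ε in 𝓝[≠] (0 : ℝ), ∀ i, W.mulVec x i < 0 →
      W.mulVec x i + ε * W.mulVec v i < 0 := by
    refine nhdsWithin_le_nhds (eventually_all.2 fun i => ?_)
    by_cases hi : W.mulVec x i < 0
    · have : Tendsto (fun ε : ℝ => W.mulVec x i + ε * W.mulVec v i) (𝓝 0)
          (𝓝 (W.mulVec x i + 0 * W.mulVec v i)) := by
        apply Continuous.tendsto (by fun_prop)
      filter_upwards [this.eventually_lt_const (by simpa using hi)] with ε hε _ using hε
    · exact Eventually.of_forall fun ε h' => absurd h' hi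
  obtain ⟨ε, hε, hε0⟩ := (hev.and self_mem_nhdsWithin).exists
  have heq : reluLayer W (x + ε • v) = reluLayer W x := by
    funext i
    simp only [reluLayer, Matrix.mulVec_add, Matrix.mulVec_smul, Pi.add_apply, Pi.smul_apply,
      smul_eq_mul]
    by_cases hi : 0 ≤ W.mulVec x i
    · rw [hvI i hi, mul_zero, add_zero]
    · have hi := not_le.1 hi
      rw [max_eq_right (hε i hi).le, max_eq_right hi.le]
  have := hinj heq
  rw [add_eq_left, smul_eq_zero] at this
  exact this.elim hε0 hv0

/-! ### The critical value: uniqueness and numerical bounds -/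

theorem continuous_erfc : Continuous erfc := by
  unfold erfc
  have : Continuous fun z : ℝ => ∫ t in (0 : ℝ)..z, Real.exp (-t ^ 2) :=
    intervalIntegral.continuous_primitive
      (fun a b => Continuous.intervalIntegrable (by fun_prop) a b) 0
  fun_prop

theorem strictAnti_erfc : StrictAnti erfc := by
  intro x y hxy
  have hpos : 0 < ∫ t in x..y, Real.exp (-t ^ 2) :=
    intervalIntegral.intervalIntegral_pos_of_pos
      (Continuous.intervalIntegrable (by fun_prop) _ _) (fun t => Real.exp_pos _) hxy
  have hadd : (∫ t in (0 : ℝ)..x, Real.exp (-t ^ 2)) + ∫ t in x..y, Real.exp (-t ^ 2) =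
      ∫ t in (0 : ℝ)..y, Real.exp (-t ^ 2) :=
    intervalIntegral.integral_add_adjacent_intervals
      (Continuous.intervalIntegrable (by fun_prop) _ _)
      (Continuous.intervalIntegrable (by fun_prop) _ _)
  have : 0 < 2 / √Real.pi := by positivity
  unfold erfc
  rw [← hadd]
  nlinarith

/-- Invert 1 + u + u²/2 ≤ exp u, using (1 - u + u²/2)(1 + u + u²/2) = 1 + u⁴/4 ≥ 1. -/
theorem Real.exp_neg_le_one_sub_add_sq_div_two {u : ℝ} (hu : 0 ≤ u) :
    Real.exp (-u) ≤ 1 - u + u ^ 2 / 2 := by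
  have h := Real.quadratic_le_exp_of_nonneg hu
  rw [Real.exp_neg, inv_le_iff_one_le_mul₀ (Real.exp_pos u)]
  have h1 : 0 ≤ 1 - u + u ^ 2 / 2 := by nlinarith [sq_nonneg (u - 1)]
  have := mul_le_mul_of_nonneg_left h h1
  nlinarith [sq_nonneg (u ^ 2)]

theorem integral_exp_neg_sq_le {z : ℝ} (hz : 0 ≤ z) :
    ∫ t in (0 : ℝ)..z, Real.exp (-t ^ 2) ≤ z - z ^ 3 / 3 + z ^ 5 / 10 := by
  calc ∫ t in (0 : ℝ)..z, Real.exp (-t ^ 2)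
      ≤ ∫ t in (0 : ℝ)..z, (1 - t ^ 2 + t ^ 4 / 2) := by
        refine intervalIntegral.integral_mono_on hz
          (Continuous.intervalIntegrable (by fun_prop) _ _)
          (Continuous.intervalIntegrable (by fun_prop) _ _) fun t _ => ?_
        have := Real.exp_neg_le_one_sub_add_sq_div_two (sq_nonneg t)
        linarith [show (t ^ 2) ^ 2 = t ^ 4 by ring]
    _ = _ := by
        rw [intervalIntegral.integral_add (Continuous.intervalIntegrable (by fun_prop) _ _)
          (Continuous.intervalIntegrable (by fun_prop) _ _),
          intervalIntegral.integral_sub (Continuous.intervalIntegrable (by fun_prop) _ _)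
          (Continuous.intervalIntegrable (by fun_prop) _ _), intervalIntegral.integral_div,
          integral_pow, integral_pow]
        norm_num
        ring

theorem le_integral_exp_neg_sq {z : ℝ} (hz : 0 ≤ z) :
    z - z ^ 3 / 3 ≤ ∫ t in (0 : ℝ)..z, Real.exp (-t ^ 2) := by
  calc z - z ^ 3 / 3 = ∫ t in (0 : ℝ)..z, (1 - t ^ 2) := by
        rw [intervalIntegral.integral_sub (Continuous.intervalIntegrable (by fun_prop) _ _)
          (Continuous.intervalIntegrable (by fun_prop) _ _), integral_pow]
        norm_num
    _ ≤ _ := by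
        refine intervalIntegral.integral_mono_on hz
          (Continuous.intervalIntegrable (by fun_prop) _ _)
          (Continuous.intervalIntegrable (by fun_prop) _ _) fun t _ => ?_
        linarith [Real.add_one_le_exp (-t ^ 2)]

/-- With z = 1/√(2c) one has 1/c = 2z², so the critical equation asks for a zero of this function.
Monotonicity gives uniqueness and the sign on either side. -/
theorem strictAntiOn_erfc_sub_sq :
    StrictAntiOn (fun z => 1 / 2 * erfc z - 2 * z ^ 2) (Set.Ici 0) := by
  intro x hx y hy hxy
  have := strictAnti_erfc hxy
  have hx : (0 : ℝ) ≤ x := hx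
  simp only
  nlinarith

/-- The bracket is chosen so that c = 1/(2z²) lies between 3.35 and 3.45. Taylor bounds on the
integral give the signs at its ends. -/
theorem exists_erfc_eq_sq :
    ∃ z ∈ Set.Ioo (0.381 : ℝ) 0.386, 1 / 2 * erfc z - 2 * z ^ 2 = 0 := by
  have hc : Continuous fun z => 1 / 2 * erfc z - 2 * z ^ 2 := by
    have := continuous_erfc
    fun_prop
  have hl : (1.7724 : ℝ) < √Real.pi := by
    rw [Real.lt_sqrt (by norm_num)]
    linarith [Real.pi_gt_d4, show (1.7724 : ℝ) ^ 2 < 3.1415 by norm_num]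
  have hu : √Real.pi < (1.7725 : ℝ) := by
    rw [Real.sqrt_lt' (by norm_num)]
    linarith [Real.pi_lt_d4, show (3.1416 : ℝ) < 1.7725 ^ 2 by norm_num]
  have hpos : 0 < √Real.pi := by positivity
  have h1 := integral_exp_neg_sq_le (z := 0.381) (by norm_num)
  have h2 := le_integral_exp_neg_sq (z := 0.386) (by norm_num)
  refine intermediate_value_Ioo' (by norm_num) hc.continuousOn ⟨?_, ?_⟩
  · have : (0.413 : ℝ) < 2 / √Real.pi * ∫ t in (0 : ℝ)..0.386, Real.exp (-t ^ 2) := by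
      rw [div_mul_eq_mul_div, lt_div_iff₀ hpos]
      norm_num at h2 ⊢
      nlinarith
    unfold erfc
    norm_num at this ⊢
    linarith
  · have : 2 / √Real.pi * (∫ t in (0 : ℝ)..0.381, Real.exp (-t ^ 2)) < 0.415 := by
      rw [div_mul_eq_mul_div, div_lt_iff₀ hpos]
      norm_num at h1 ⊢
      nlinarith
    unfold erfc
    norm_num at this ⊢
    linarith

theorem two_mul_one_div_sqrt_sq {c : ℝ} (hc : 0 < c) : 2 * (1 / √(2 * c)) ^ 2 = 1 / c := by
  rw [div_pow, Real.sq_sqrt (by positivity)]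
  field_simp

theorem exists_critical_expansivity :
    ∃ c₀ : ℝ, IsCriticalExpansivity c₀ ∧ (∀ c, IsCriticalExpansivity c → c = c₀) ∧
      |c₀ - 3.4| < 0.05 ∧ ∀ c, 0 < c → c < c₀ → 1 / 2 * erfc (1 / √(2 * c)) < 1 / c := by
  obtain ⟨z, ⟨hz1, hz2⟩, hz⟩ := exists_erfc_eq_sq
  have hz0 : 0 < z := by linarith
  have hzc : 1 / √(2 * (1 / (2 * z ^ 2))) = z := by
    rw [show 2 * (1 / (2 * z ^ 2)) = (1 / z) ^ 2 by field_simp, Real.sqrt_sq (by positivity)]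
    field_simp
  refine ⟨1 / (2 * z ^ 2), ⟨by positivity, ?_⟩, fun c hc => ?_, ?_, fun c hc0 hc => ?_⟩
  · rw [hzc, one_div_one_div]
    linarith
  · have h1 : 1 / √(2 * c) = z := by
      refine strictAntiOn_erfc_sub_sq.injOn (by simp) hz0.le ?_
      rw [two_mul_one_div_sqrt_sq hc.1, hz, hc.2, sub_self]
    rw [← h1, two_mul_one_div_sqrt_sq hc.1, one_div_one_div]
  · rw [abs_lt]
    constructor
    · rw [lt_sub_iff_add_lt, lt_div_iff₀ (by positivity)]
      nlinarith
    · rw [sub_lt_iff_lt_add, div_lt_iff₀ (by positivity)]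
      nlinarith
  · have h1 : z < 1 / √(2 * c) := by
      rw [← hzc]
      apply one_div_lt_one_div_of_lt (by positivity)
      exact Real.sqrt_lt_sqrt (by positivity) (by linarith)
    have := strictAntiOn_erfc_sub_sq (Set.mem_Ici.2 hz0.le) (by simp) h1
    simp only at this
    rw [hz, two_mul_one_div_sqrt_sq hc0] at this
    linarith

/-! ### Gaussian tail, orthogonal invariance and concentration -/

theorem gaussianReal_real_Iic_neg (a : ℝ) :
    (gaussianReal 0 1).real (Set.Iic (-a)) = 1 / 2 * erfc (a / √2) := by
  have hint : Integrable fun x : ℝ => Real.exp (-(1 / 2) * x ^ 2) :=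
    integrable_exp_neg_mul_sq (by norm_num)
  have h0 := integral_gaussian_Ioi (1 / 2)
  have hsplit := intervalIntegral.integral_interval_add_Ioi (a := 0) (b := a)
    hint.integrableOn hint.integrableOn
  have hsub : ∫ x in (0 : ℝ)..a, Real.exp (-(1 / 2) * x ^ 2) =
      √2 * ∫ t in (0 : ℝ)..a / √2, Real.exp (-t ^ 2) := by
    have := intervalIntegral.integral_comp_div (a := 0) (b := a) (c := √2)
      (fun t : ℝ => Real.exp (-t ^ 2)) (by positivity)
    rw [zero_div, smul_eq_mul] at this
    rw [← this]
    congr 1 with x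
    rw [div_pow, Real.sq_sqrt (by norm_num)]
    ring_nf
  have hpdf : ∫ x in Set.Iic (-a), gaussianPDFReal 0 1 x =
      (√(2 * Real.pi))⁻¹ * ∫ x in Set.Ioi a, Real.exp (-(1 / 2) * x ^ 2) := by
    have := integral_comp_neg_Iic (-a) fun x : ℝ => Real.exp (-(1 / 2) * x ^ 2)
    rw [neg_neg] at this
    rw [← this, ← integral_const_mul]
    congr 1 with x
    simp only [gaussianPDFReal, NNReal.coe_one, mul_one, sub_zero]
    ring_nf
  rw [measureReal_def, gaussianReal_apply_eq_integral _ one_ne_zero,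
    ENNReal.toReal_ofReal (integral_nonneg fun x => gaussianPDFReal_nonneg _ _ _), hpdf,
    ← add_sub_cancel_left (∫ x in (0 : ℝ)..a, Real.exp (-(1 / 2) * x ^ 2))
      (∫ x in Set.Ioi a, Real.exp (-(1 / 2) * x ^ 2)), hsplit, h0, hsub, erfc,
    show Real.pi / (1 / 2) = 2 * Real.pi by ring, Real.sqrt_mul (by norm_num)]
  have : 0 < √Real.pi := by positivity
  have : 0 < √2 := by positivity
  field_simp

open scoped Matrix in
/-- A matrix with orthonormal rows maps the standard Gaussian to the standard Gaussian. -/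
theorem measurePreserving_mulVec_gaussian {ι κ : Type*} [Fintype ι] [Fintype κ] [DecidableEq ι]
    (B : Matrix ι κ ℝ) (hB : B * Bᵀ = 1) :
    MeasurePreserving (fun x => B.mulVec x) (Measure.pi fun _ : κ => gaussianReal 0 1)
      (Measure.pi fun _ : ι => gaussianReal 0 1) := by
  have hmeas : Measurable fun x : κ → ℝ => B.mulVec x :=
    (Continuous.matrix_mulVec continuous_const continuous_id).measurable
  refine ⟨hmeas, ?_⟩
  have : IsProbabilityMeasure
      ((Measure.pi fun _ : κ => gaussianReal 0 1).map fun x => B.mulVec x) :=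
    Measure.isProbabilityMeasure_map hmeas.aemeasurable
  rw [← charFun_eq_pi_iff]
  intro t
  -- The characteristic function of Bx at t is that of x at tB, and |tB| = |t| because the rows of B
  -- are orthonormal.
  have hcomp : charFun ((((Measure.pi fun _ : κ => gaussianReal 0 1).map
      fun x => B.mulVec x)).map (WithLp.toLp 2)) t =
      charFun ((Measure.pi fun _ : κ => gaussianReal 0 1).map (WithLp.toLp 2))
        (WithLp.toLp 2 (t.ofLp ᵥ* B)) := by
    rw [Measure.map_map (by fun_prop) hmeas, charFun_apply, charFun_apply,
      integral_map (by fun_prop) (by fun_prop), integral_map (by fun_prop) (by fun_prop)]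
    congr 1 with x
    simp only [Function.comp_apply, EuclideanSpace.inner_eq_star_dotProduct, star_trivial]
    rw [Matrix.dotProduct_mulVec]
  rw [hcomp, charFun_pi]
  simp_rw [charFun_gaussianReal, ← Complex.exp_sum]
  congr 1
  have hsq : ∑ i, (t.ofLp ᵥ* B) i ^ 2 = ∑ i, t.ofLp i ^ 2 := by
    have : (t.ofLp ᵥ* B) ⬝ᵥ (t.ofLp ᵥ* B) = t.ofLp ⬝ᵥ t.ofLp := by
      nth_rewrite 2 [← Matrix.mulVec_transpose]
      rw [Matrix.dotProduct_mulVec, Matrix.vecMul_vecMul, hB, Matrix.vecMul_one]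
    simpa [dotProduct, pow_two] using this
  have := congrArg (fun r : ℝ => (-(r : ℂ) / 2)) hsq
  simpa [neg_div, Finset.sum_div] using this

/-- Chebyshev's inequality for the empirical mean of `f` over `m` independent samples. -/
theorem pi_empirical_deviation_le {μ : Measure ℝ} [IsProbabilityMeasure μ] {f : ℝ → ℝ}
    (hf : MemLp f 2 μ) {m : ℕ} (hm : 0 < m) {δ : ℝ} (hδ : 0 < δ) :
    (Measure.pi fun _ : Fin m => μ) {x | m * δ ≤ |∑ i, f (x i) - m * ∫ y, f y ∂μ|} ≤
      ENNReal.ofReal (variance f μ / δ ^ 2 / m) := by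
  have hmR : (0 : ℝ) < m := by exact_mod_cast hm
  have hcomp : ∀ i, MemLp (fun x : Fin m → ℝ => f (x i)) 2 (Measure.pi fun _ : Fin m => μ) :=
    fun i => hf.comp_measurePreserving (measurePreserving_eval (fun _ : Fin m => μ) i)
  have hX : MemLp (∑ i, fun x : Fin m → ℝ => f (x i)) 2 (Measure.pi fun _ : Fin m => μ) :=
    memLp_finsetSum' _ fun i _ => hcomp i
  have h := meas_ge_le_variance_div_sq hX (c := m * δ) (by positivity)
  have hvar := variance_sum_pi (μ := fun _ : Fin m => μ) (X := fun _ => f) fun _ => hf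
  rw [hvar] at h
  have hmean : ∫ x, (∑ i, fun x : Fin m → ℝ => f (x i)) x ∂(Measure.pi fun _ : Fin m => μ) =
      m * ∫ y, f y ∂μ := by
    simp only [Finset.sum_apply]
    rw [integral_finsetSum _ fun i _ => (hcomp i).integrable (by norm_num)]
    have : ∀ i : Fin m, ∫ x : Fin m → ℝ, f (x i) ∂(Measure.pi fun _ : Fin m => μ) =
        ∫ y, f y ∂μ := fun i => by
      have hmp := measurePreserving_eval (fun _ : Fin m => μ) i
      have h2 := integral_map (f := f) hmp.measurable.aemeasurable (by
        rw [hmp.map_eq]; exact hf.aestronglyMeasurable)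
      rw [hmp.map_eq] at h2
      exact h2.symm
    simp [this]
  rw [hmean] at h
  simp only [Finset.sum_apply] at h
  refine h.trans (ENNReal.ofReal_le_ofReal (le_of_eq ?_))
  simp
  field_simp

theorem tendsto_pi_empirical_deviation {μ : Measure ℝ} [IsProbabilityMeasure μ] {f : ℝ → ℝ}
    (hf : MemLp f 2 μ) {m : ℕ → ℕ} (hm : Tendsto m atTop atTop) {δ : ℝ} (hδ : 0 < δ) :
    Tendsto (fun k => (Measure.pi fun _ : Fin (m k) => μ)
      {x | m k * δ ≤ |∑ i, f (x i) - m k * ∫ y, f y ∂μ|}) atTop (𝓝 0) := by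
  have hlim : Tendsto (fun k => ENNReal.ofReal (variance f μ / δ ^ 2 / m k)) atTop (𝓝 0) := by
    rw [← ENNReal.ofReal_zero]
    exact ENNReal.tendsto_ofReal
      (tendsto_const_nhds.div_atTop (tendsto_natCast_atTop_atTop.comp hm))
  refine tendsto_of_tendsto_of_tendsto_of_le_of_le' tendsto_const_nhds hlim
    (Eventually.of_forall fun _ => zero_le) ?_
  filter_upwards [hm.eventually_gt_atTop 0] with k hk using pi_empirical_deviation_le hf hk hδ

/-! ### Splitting off the column means -/

/-- The Gaussian matrix obtained from a Gaussian matrix `G` by replacing the column means with an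
independent Gaussian vector `s / √m`. -/
noncomputable def recenter {m n : ℕ} (p : (Fin n → ℝ) × (Fin m × Fin n → ℝ)) :
    Fin m × Fin n → ℝ :=
  fun q => p.2 q - (∑ i, p.2 (i, q.2)) / m + p.1 q.2 / √m

/-- The map is linear with orthonormal rows: within a column, centring leaves covariance δ_{ii'} -
1/m, and s / √m restores the missing 1/m. -/
theorem measurePreserving_recenter {m n : ℕ} (hm : 0 < m) :
    MeasurePreserving (recenter (m := m) (n := n))
      ((Measure.pi fun _ : Fin n => gaussianReal 0 1).prod
        (Measure.pi fun _ : Fin m × Fin n => gaussianReal 0 1))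
      (Measure.pi fun _ : Fin m × Fin n => gaussianReal 0 1) := by
  have hmR : (0 : ℝ) < m := by exact_mod_cast hm
  let B : Matrix (Fin m × Fin n) (Fin n ⊕ Fin m × Fin n) ℝ := fun q r =>
    r.elim (fun j => if j = q.2 then 1 / √m else 0)
      (fun r => (if r = q then 1 else 0) - if r.2 = q.2 then 1 / (m : ℝ) else 0)
  have hB : B * B.transpose = 1 := by
    ext ⟨i, j⟩ ⟨i', j'⟩
    have hs : (√(m : ℝ))⁻¹ * (√(m : ℝ))⁻¹ = 1 / m := by
      rw [← mul_inv, Real.mul_self_sqrt hmR.le, one_div]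
    rw [Matrix.mul_apply, Fintype.sum_sum_type, Matrix.one_apply]
    simp only [Matrix.transpose_apply]
    simp only [B, Sum.elim_inl, Sum.elim_inr, sub_mul, mul_sub,
      Finset.sum_sub_distrib, Fintype.sum_prod_type, Prod.mk.injEq]
    by_cases hj : j = j'
    · subst hj
      by_cases hi : i = i'
      · subst hi
        simp [ite_and, hs]
        field_simp
        ring
      · simp [ite_and, hs, hi, Ne.symm hi]
        field_simp
        ring
    · simp [ite_and, hj, Ne.symm hj]
  have h := (measurePreserving_mulVec_gaussian B hB).comp
    (measurePreserving_sumPiEquivProdPi_symm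
      (fun _ : Fin n ⊕ Fin m × Fin n => gaussianReal 0 1))
  convert h using 1
  ext p ⟨i, j⟩
  simp [recenter, B, Matrix.mulVec, dotProduct, Fintype.sum_sum_type, Fintype.sum_prod_type,
    sub_mul, Finset.sum_sub_distrib, MeasurableEquiv.sumPiEquivProdPi,
    div_eq_inv_mul, Finset.mul_sum]
  ring

/-- The image of the direction of `p.1` under the matrix `p.2`. -/
noncomputable def directionImage {m n : ℕ} (p : (Fin n → ℝ) × (Fin m × Fin n → ℝ)) : Fin m → ℝ :=
  fun i => ∑ j, p.2 (i, j) * (p.1 j / √(∑ j, p.1 j ^ 2))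

/-- For each fixed s ≠ 0, pairing the rows with the unit vector s/|s| is a map with orthonormal
rows, so the conditional law does not depend on s. Since n > 0, s ≠ 0 almost surely. -/
theorem measurePreserving_directionImage {m n : ℕ} (hn : 0 < n) :
    MeasurePreserving (directionImage (m := m) (n := n))
      ((Measure.pi fun _ : Fin n => gaussianReal 0 1).prod
        (Measure.pi fun _ : Fin m × Fin n => gaussianReal 0 1))
      (Measure.pi fun _ : Fin m => gaussianReal 0 1) := by
  have hmeas : Measurable (directionImage (m := m) (n := n)) := by
    unfold directionImage
    fun_prop
  have := nullSingletonClass_gaussianReal (μ := 0) one_ne_zero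
  have hskew := (MeasurePreserving.id (Measure.pi fun _ : Fin n => gaussianReal 0 1)).skew_product
    (μc := Measure.pi fun _ : Fin m × Fin n => gaussianReal 0 1)
    (μd := Measure.pi fun _ : Fin m => gaussianReal 0 1)
    (g := fun s G => directionImage (s, G)) hmeas (by
      filter_upwards [Measure.ae_eval_ne (μ := fun _ : Fin n => gaussianReal 0 1) ⟨0, hn⟩ 0]
        with s hs
      have hpos : 0 < ∑ j, s j ^ 2 :=
        Finset.sum_pos' (fun i _ => sq_nonneg _) ⟨⟨0, hn⟩, Finset.mem_univ _, by positivity⟩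
      let B : Matrix (Fin m) (Fin m × Fin n) ℝ := fun i q =>
        if q.1 = i then s q.2 / √(∑ j, s j ^ 2) else 0
      have hB : B * B.transpose = 1 := by
        ext i i'
        rw [Matrix.mul_apply, Fintype.sum_prod_type, Matrix.one_apply]
        simp only [Matrix.transpose_apply]
        simp only [B]
        by_cases hi : i = i'
        · subst hi
          simp [← pow_two, div_pow, Real.sq_sqrt hpos.le, ← Finset.sum_div, hpos.ne']
        · simp [hi, Ne.symm hi]
      have := (measurePreserving_mulVec_gaussian B hB).map_eq
      convert this using 2
      ext G i
      simp [directionImage, B, Matrix.mulVec, dotProduct, Fintype.sum_prod_type, mul_comm])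
  exact measurePreserving_snd.comp hskew

/-! ### Counting the rows with nonpositive product -/

/-- The event that fewer than `n` rows of the `m × n` matrix `M` have a nonpositive inner product
with the sum of all rows. -/
def fewNonposRows (m n : ℕ) : Set (Fin m × Fin n → ℝ) :=
  {M | (Finset.univ.filter fun i => ∑ j, M (i, j) * ∑ i', M (i', j) ≤ 0).card < n}

theorem measurableSet_fewNonposRows (m n : ℕ) : MeasurableSet (fewNonposRows m n) := by
  unfold fewNonposRows
  simp_rw [Finset.card_filter]
  refine measurableSet_lt (Finset.measurable_sum _ fun i _ => ?_) measurable_const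
  exact Measurable.ite (measurableSet_le (by fun_prop) (by fun_prop)) measurable_const
    measurable_const

/-- The centred part has zero column sums, so the row sum is √m s; factor |s| out of each product
with s. -/
theorem sum_recenter_mul_sum {m n : ℕ} (hm : 0 < m) (p : (Fin n → ℝ) × (Fin m × Fin n → ℝ))
    (i : Fin m) (hr : 0 < ∑ j, p.1 j ^ 2) :
    ∑ j, recenter p (i, j) * ∑ i', recenter p (i', j) =
      √m * √(∑ j, p.1 j ^ 2) * (directionImage p i - (∑ i', directionImage p i') / m +
        √(∑ j, p.1 j ^ 2) / √m) := by
  have hmR : (0 : ℝ) < m := by exact_mod_cast hm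
  have hsm : √(m : ℝ) * √(m : ℝ) = m := Real.mul_self_sqrt hmR.le
  have hsm0 : 0 < √(m : ℝ) := by positivity
  have hcol : ∀ j, ∑ i', recenter p (i', j) = √m * p.1 j := fun j => by
    simp only [recenter, Finset.sum_add_distrib, Finset.sum_sub_distrib, Finset.sum_const,
      Finset.card_univ, Fintype.card_fin, nsmul_eq_mul]
    rw [mul_div_cancel₀ _ hmR.ne', sub_self, zero_add]
    field_simp
    rw [pow_two, hsm, mul_comm]
  set r := √(∑ j, p.1 j ^ 2) with hrdef
  have hr0 : 0 < r := Real.sqrt_pos.2 hr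
  have hdir : ∀ i, ∑ j, p.2 (i, j) * p.1 j = r * directionImage p i := fun i => by
    rw [directionImage, Finset.mul_sum]
    refine Finset.sum_congr rfl fun j _ => ?_
    rw [← hrdef]
    field_simp
  have hsq : ∑ j, p.1 j * p.1 j = r * r := by
    rw [Real.mul_self_sqrt hr.le]
    simp [pow_two]
  have hmean : ∑ j, (∑ i', p.2 (i', j)) * p.1 j = r * ∑ i', directionImage p i' := by
    simp_rw [Finset.sum_mul]
    rw [Finset.sum_comm, Finset.mul_sum]
    exact Finset.sum_congr rfl fun i _ => hdir i
  calc ∑ j, recenter p (i, j) * ∑ i', recenter p (i', j)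
      = √m * (∑ j, p.2 (i, j) * p.1 j - (∑ j, (∑ i', p.2 (i', j)) * p.1 j) / m +
          (∑ j, p.1 j * p.1 j) / √m) := by
        rw [Finset.sum_div, Finset.sum_div, ← Finset.sum_sub_distrib, ← Finset.sum_add_distrib,
          Finset.mul_sum]
        refine Finset.sum_congr rfl fun j _ => ?_
        rw [hcol, recenter]
        ring
    _ = _ := by
        rw [hdir, hsq, hmean]
        ring

/-- A nonpositive product forces g_i ≤ mean(g) - |s|/√m ≤ δ - ρ ≤ -a, so the bad rows are among
those counted in `hcount`. -/
theorem recenter_mem_fewNonposRows {m n : ℕ} (hm : 0 < m)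
    {p : (Fin n → ℝ) × (Fin m × Fin n → ℝ)} {a δ ρ : ℝ} (hρ : 0 < ρ)
    (hs : ρ ^ 2 * m ≤ ∑ j, p.1 j ^ 2) (haδ : a + δ ≤ ρ)
    (hmean : ∑ i, directionImage p i ≤ m * δ)
    (hcount : (Finset.univ.filter fun i => directionImage p i ≤ -a).card < n) :
    recenter p ∈ fewNonposRows m n := by
  have hmR : (0 : ℝ) < m := by exact_mod_cast hm
  have hr : 0 < ∑ j, p.1 j ^ 2 := lt_of_lt_of_le (by positivity) hs
  refine lt_of_le_of_lt (Finset.card_le_card fun i hi => ?_) hcount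
  simp only [Finset.mem_filter, Finset.mem_univ, true_and] at hi ⊢
  rw [sum_recenter_mul_sum hm p i hr] at hi
  have h1 := nonpos_of_mul_nonpos_right hi (by positivity)
  have h2 : (∑ i', directionImage p i') / m ≤ δ := by
    rw [div_le_iff₀ hmR]
    linarith
  have h3 : ρ ≤ √(∑ j, p.1 j ^ 2) / √m := by
    rw [← Real.sqrt_div' _ hmR.le]
    apply Real.le_sqrt_of_sq_le
    rwa [le_div_iff₀ hmR]
  linarith

/-- Union bound over the three ways to fail: |s|² too small, mean(g) too large, too many g_i ≤ -a.
Each event involves iid normals only, so no joint law is needed. -/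
theorem gaussian_compl_fewNonposRows_le {m n : ℕ} (hm : 0 < m) (hn : 0 < n) {a δ ε η p ρ : ℝ}
    (hρ : 0 < ρ) (hρn : ρ ^ 2 * m ≤ n * (1 - ε)) (haδ : a + δ ≤ ρ) (hη : m * (p + η) ≤ n) :
    (Measure.pi fun _ : Fin m × Fin n => gaussianReal 0 1) (fewNonposRows m n)ᶜ ≤
      (Measure.pi fun _ : Fin n => gaussianReal 0 1) {x | n * ε ≤ |∑ j, x j ^ 2 - n * 1|} +
      (Measure.pi fun _ : Fin m => gaussianReal 0 1) {x | m * δ ≤ |∑ i, x i - m * 0|} +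
      (Measure.pi fun _ : Fin m => gaussianReal 0 1)
        {x | m * η ≤ |∑ i, (Set.Iic (-a)).indicator 1 (x i) - m * p|} := by
  have hind : Measurable ((Set.Iic (-a)).indicator (1 : ℝ → ℝ)) :=
    measurable_one.indicator measurableSet_Iic
  have hdir := measurePreserving_directionImage (m := m) hn
  rw [← (measurePreserving_recenter hm).measure_preimage
      (measurableSet_fewNonposRows m n).compl.nullMeasurableSet,
    ← (measurePreserving_fst (μ := Measure.pi fun _ : Fin n => gaussianReal 0 1)
      (ν := Measure.pi fun _ : Fin m × Fin n => gaussianReal 0 1)).measure_preimage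
      (measurableSet_le (by fun_prop) (by fun_prop)).nullMeasurableSet,
    ← hdir.measure_preimage (measurableSet_le (by fun_prop) (by fun_prop)).nullMeasurableSet,
    ← hdir.measure_preimage (measurableSet_le (by fun_prop) (by fun_prop)).nullMeasurableSet]
  refine (measure_mono fun q hq => ?_).trans
    ((measure_union_le _ _).trans (add_le_add_left (measure_union_le _ _) _))
  by_contra hnot
  simp only [Set.mem_union, Set.mem_preimage, Set.mem_ofPred_eq, not_or, not_le, abs_lt] at hnot
  obtain ⟨⟨h1, h2⟩, h3⟩ := hnot
  refine hq (recenter_mem_fewNonposRows hm hρ ?_ haδ ?_ (a := a) ?_)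
  · linarith
  · linarith
  · have hc : (((Finset.univ.filter fun i => directionImage q i ≤ -a).card : ℕ) : ℝ) =
        ∑ i, (Set.Iic (-a)).indicator 1 (directionImage q i) := by
      simp [Set.indicator_apply]
    have : (((Finset.univ.filter fun i => directionImage q i ≤ -a).card : ℕ) : ℝ) < n := by
      rw [hc]
      linarith
    exact_mod_cast this

/-! ### Passage to the limit -/

/-- The limiting threshold is a = 1/√c. As the inequality is strict, continuity lets a drop slightly
below it, leaving room for ρ in between and for the errors δ and ε. -/
theorem exists_margin {c : ℝ} (hc : 0 < c) (h : 1 / 2 * erfc (1 / √(2 * c)) < 1 / c) :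
    ∃ a δ ε ρ : ℝ, 0 < δ ∧ 0 < ε ∧ 0 < ρ ∧ a + δ ≤ ρ ∧ ρ ^ 2 < 1 / c * (1 - ε) ∧
      (gaussianReal 0 1).real (Set.Iic (-a)) < 1 / c := by
  have hcont : Continuous fun a : ℝ => 1 / 2 * erfc (a / √2) :=
    continuous_const.mul (continuous_erfc.comp (by fun_prop))
  have hval : 1 / √c / √2 = 1 / √(2 * c) := by
    rw [Real.sqrt_mul (by norm_num), div_div, mul_comm]
  have hev : ∀ᶠ a in 𝓝[<] (1 / √c), 1 / 2 * erfc (a / √2) < 1 / c :=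
    nhdsWithin_le_nhds (hcont.continuousAt.eventually_lt_const (by simpa only [hval] using h))
  have hpos : 0 < 1 / √c := by positivity
  obtain ⟨a, ⟨ha, ha1⟩, ha0⟩ := ((hev.and self_mem_nhdsWithin).and
    (nhdsWithin_le_nhds (lt_mem_nhds hpos))).exists
  have ha1 : a < 1 / √c := ha1
  obtain ⟨ρ, hρ1, hρ2⟩ := exists_between ha1
  have hρ0 : 0 < ρ := ha0.trans hρ1
  have hsq : ρ ^ 2 < 1 / c := by
    have := pow_lt_pow_left₀ hρ2 hρ0.le two_ne_zero
    rwa [div_pow, one_pow, Real.sq_sqrt hc.le] at this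
  -- ε is half the gap between cρ² and 1.
  refine ⟨a, ρ - a, (1 - c * ρ ^ 2) / 2, ρ, by linarith, ?_, hρ0, by linarith, ?_, ?_⟩
  · rw [lt_div_iff₀ hc] at hsq
    linarith
  · rw [lt_div_iff₀ hc] at hsq
    rw [one_div_mul_eq_div, lt_div_iff₀ hc]
    linarith
  · rwa [gaussianReal_real_Iic_neg]

theorem tendsto_gaussian_fewNonposRows {c : ℝ} (hc : 0 < c)
    (h : 1 / 2 * erfc (1 / √(2 * c)) < 1 / c) {m n : ℕ → ℕ} (hn : Tendsto n atTop atTop)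
    (hmn : Tendsto (fun k => (m k : ℝ) / (n k : ℝ)) atTop (𝓝 c)) :
    Tendsto (fun k => (Measure.pi fun _ : Fin (m k) × Fin (n k) => gaussianReal 0 1)
      (fewNonposRows (m k) (n k))ᶜ) atTop (𝓝 0) := by
  obtain ⟨a, δ, ε, ρ, hδ, hε, hρ, haδ, hρε, hp⟩ := exists_margin hc h
  set p := (gaussianReal 0 1).real (Set.Iic (-a)) with hpdef
  obtain ⟨q, hpq, hq⟩ := exists_between hp
  have hnR : Tendsto (fun k => (n k : ℝ)) atTop atTop := tendsto_natCast_atTop_atTop.comp hn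
  have hmR : Tendsto (fun k => (m k : ℝ)) atTop atTop := by
    refine (hmn.pos_mul_atTop hc hnR).congr' ?_
    filter_upwards [hn.eventually_gt_atTop 0] with k hk
    have : (n k : ℝ) ≠ 0 := by exact_mod_cast hk.ne'
    field_simp
  have hm : Tendsto m atTop atTop := tendsto_natCast_atTop_iff.1 hmR
  have hinv : Tendsto (fun k => (n k : ℝ) / m k) atTop (𝓝 (1 / c)) := by
    simpa using hmn.inv₀ hc.ne'
  have hid : MemLp (fun x : ℝ => x) 2 (gaussianReal 0 1) := memLp_id_gaussianReal 2
  -- Chebyshev for the squares needs x² in L², that is, a finite fourth moment.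
  have hsq : MemLp (fun x : ℝ => x ^ 2) 2 (gaussianReal 0 1) := by
    have := (memLp_id_gaussianReal' (μ := 0) (v := 1) 4 (by norm_num)).norm_rpow_div 2
    have h42 : (4 : ENNReal) / 2 = 2 := by
      rw [eq_comm, ENNReal.eq_div_iff (by norm_num) (by norm_num)]
      norm_num
    simpa [h42] using this
  have hind : MemLp ((Set.Iic (-a)).indicator (1 : ℝ → ℝ)) 2 (gaussianReal 0 1) :=
    (memLp_const 1).indicator measurableSet_Iic
  have hm1 : ∫ x, x ^ 2 ∂(gaussianReal 0 1) = 1 := by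
    have h1 := variance_of_integral_eq_zero (μ := gaussianReal 0 1) (X := fun x : ℝ => x)
      aemeasurable_id' integral_id_gaussianReal
    rw [← h1]
    exact variance_id_gaussianReal
  have t1 := tendsto_pi_empirical_deviation hsq hn hε
  have t2 := tendsto_pi_empirical_deviation hid hm hδ
  have t3 := tendsto_pi_empirical_deviation hind hm (sub_pos.2 hpq)
  rw [hm1] at t1
  rw [integral_id_gaussianReal] at t2
  rw [integral_indicator_one measurableSet_Iic, ← hpdef] at t3
  have hsum := (t1.add t2).add t3
  rw [add_zero, add_zero] at hsum
  refine tendsto_of_tendsto_of_tendsto_of_le_of_le' tendsto_const_nhds hsum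
    (Eventually.of_forall fun _ => zero_le) ?_
  filter_upwards [hn.eventually_gt_atTop 0, hm.eventually_gt_atTop 0,
    hinv.eventually_const_lt hq, (hinv.mul_const (1 - ε)).eventually_const_lt hρε]
    with k hnk hmk hqk hρk
  have hmkR : (0 : ℝ) < m k := by exact_mod_cast hmk
  refine gaussian_compl_fewNonposRows_le hmk hnk hρ ?_ haδ ?_
  · rw [div_mul_eq_mul_div, lt_div_iff₀ hmkR] at hρk
    exact hρk.le
  · rw [lt_div_iff₀ hmkR] at hqk
    linarith

theorem IsStdGaussianMatrix.measure_fewNonposRows_le {Ω : Type*} [MeasurableSpace Ω]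
    {P : Measure Ω} [IsProbabilityMeasure P] {m n : ℕ} {W : Ω → Matrix (Fin m) (Fin n) ℝ}
    (hW : IsStdGaussianMatrix P W) :
    (Measure.pi fun _ : Fin m × Fin n => gaussianReal 0 1) (fewNonposRows m n) ≤
      P {ω | ¬ Function.Injective (reluLayer (W ω))} := by
  have hlaw : HasLaw (fun ω (q : Fin m × Fin n) => W ω q.1 q.2)
      (Measure.pi fun _ => gaussianReal 0 1) P :=
    (iIndepFun_iff_hasLaw_pi_pi fun q : Fin m × Fin n => hW.hasLaw_entry q.1 q.2).1 hW.iIndepFun_entry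
  rw [← hlaw.map_eq,
    Measure.map_apply_of_aemeasurable hlaw.aemeasurable (measurableSet_fewNonposRows m n)]
  -- The test point is minus the row sum; the sign turns nonpositive products into nonnegative ones.
  refine measure_mono fun ω hω => not_injective_reluLayer (W ω) (fun j => -∑ i, W ω i j) ?_
  simpa [fewNonposRows, Matrix.mulVec, dotProduct] using hω

theorem not_injective_reluLayer_of_lt {m n : ℕ} (h : m < n) (W : Matrix (Fin m) (Fin n) ℝ) :
    ¬ Function.Injective (reluLayer W) :=
  not_injective_reluLayer W 0 <|
    (Finset.card_filter_le _ _).trans_lt (by simpa using h)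

theorem theorem6 :
    ∃ cstar : ℝ,
      -- `cstar` is the unique positive real solution of the equation
      IsCriticalExpansivity cstar ∧
      (∀ c : ℝ, IsCriticalExpansivity c → c = cstar) ∧
      -- to one decimal place, `cstar` is `3.4`
      |cstar - 3.4| < 0.05 ∧
      -- below `cstar`, the layer is non-injective with probability tending to one
      ∀ (c : ℝ), c < cstar →
        ∀ (m n : ℕ → ℕ), Tendsto n atTop atTop →
          Tendsto (fun k => (m k : ℝ) / (n k : ℝ)) atTop (𝓝 c) →
          ∀ (Ω : ℕ → Type*) [∀ k, MeasurableSpace (Ω k)]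
            (P : ∀ k, Measure (Ω k)) [∀ k, IsProbabilityMeasure (P k)]
            (W : ∀ k, Ω k → Matrix (Fin (m k)) (Fin (n k)) ℝ),
            (∀ k, IsStdGaussianMatrix (P k) (W k)) →
            Tendsto (fun k => P k {ω | ¬ Function.Injective (reluLayer (W k ω))})
              atTop (𝓝 1) := by
  obtain ⟨c₀, h0, huniq, hnear, hlt⟩ := exists_critical_expansivity
  refine ⟨c₀, h0, huniq, hnear, fun c hc m n hn hmn Ω _ P _ W hW => ?_⟩
  rcases le_or_gt c 0 with hc0 | hc0
  -- For c ≤ 0 eventually m < n, and non-injectivity is deterministic.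
  · refine tendsto_const_nhds.congr' ?_
    filter_upwards [hn.eventually_gt_atTop 0, hmn.eventually_lt_const (hc0.trans_lt one_pos)]
      with k hk hmk
    have hkR : (0 : ℝ) < n k := by exact_mod_cast hk
    rw [div_lt_one hkR, Nat.cast_lt] at hmk
    simp [not_injective_reluLayer_of_lt hmk]
  · have hbad := tendsto_gaussian_fewNonposRows hc0 (hlt c hc0 hc) hn hmn
    have hgood := ENNReal.Tendsto.sub (tendsto_const_nhds (x := (1 : ENNReal))) hbad
      (Or.inl ENNReal.one_ne_top)
    rw [tsub_zero] at hgood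
    refine tendsto_of_tendsto_of_tendsto_of_le_of_le hgood tendsto_const_nhds (fun k => ?_)
      fun k => prob_le_one
    refine le_trans ?_ (hW k).measure_fewNonposRows_le
    rw [← prob_compl_eq_one_sub (measurableSet_fewNonposRows _ _).compl, compl_compl]
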